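/- Let $d,n\ge 0$ be integers and consider complex matrices on $(\mathbb{C}^d)^{\otimes n}$ with computational basis $|i\rangle=|i_1\cdots i_n\rangle$, $i\in[d]^n$. For $\pi\in S_n$ let $P_\pi|i_1\cdots i_n\rangle=|i_{\pi^{-1}(1)}\cdots i_{\pi^{-1}(n)}\rangle$ and let $\Pi=\frac{1}{n!}\sum_{\pi\in S_n}P_\pi$ be the projection onto the symmetric subspace. A matrix $X$ is called bosonic if $\Pi X\Pi=X$. Let $\operatorname{Herm}[\mathsf{DS}^{(n)}_d]$ be the set of Hermitian bosonic matrices $X$ such that $U^{\otimes n}X=XU^{\otimes n}$ for every diagonal unitary $U=\operatorname{diag}(e^{i\theta_1},\dots,e^{i\theta_d})$. For $\alpha\in\mathbb{N}^d$ with $|\alpha|=\sum_j\alpha_j=n$, the Dicke state is $|D_\alpha\rangle=\binom{n}{\alpha}^{-1/2}\sum_{i}|i\rangle$, where the sum runs over the $i\in[d]^n$ in which each $j\in[d]$ occurs exactly $\alpha_j$ times. A mixture of Dicke states is a matrix $\sum_{|\alpha|=n}p_\alpha|D_\alpha\rangle\langle D_\alpha|$ with $p_\alpha\ge0$ and $\sum_\alpha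 p_\alpha=1$; such matrices belong to $\operatorname{Herm}[\mathsf{DS}^{(n)}_d]$. For $I\subseteq[n]$ let $X^{\Gamma_I}$ be the partial transpose of $X$ on the tensor factors indexed by $I$; $X$ is PPT with respect to the bipartition $I:[n]\setminus I$ if $X^{\Gamma_I}$ is positive semidefinite. For $0\le k\le\lfloor n/2\rfloor$ let $\mathsf{PPT}^{(n,k)}_d$ be the cone of Hermitian bosonic matrices $X$ with $X^{\Gamma_{\{1,\dots,k\}}}\succeq0$. **Corollary.** 1. For every $0\le l\le\lfloor n/2\rfloor$, $$\mathsf{PPT}^{(n,\lfloor n/2\rfloor)}_d\cap\operatorname{Herm}[\mathsf{DS}^{(n)}_d]\subseteq\mathsf{PPT}^{(n,l)}_d\cap\operatorname{Herm}[\mathsf{DS}^{(n)}_d].$$ 2. Let $X\in\operatorname{Herm}[\mathsf{DS}^{(n)}_d]$. If $X$ is PPT with respect to a most balanced bipartition $I_0:[n]\setminus I_0$, $|I_0|=\lfloor n/2\rfloor$, then $X$ is PPT with respect to $I:[n]\setminus I$ for every $I\subseteq[n]$. 3. In particular, a mixture of Dicke states that is PPT with respect to a most balanced bipartition is PPT with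 respect to every bipartition. This settles Conjecture III.1 of Romero-Pallejà et al. in the affirmative. -/

import Mathlib

open scoped ComplexOrder

noncomputable section

namespace DickePPT

/-- Multi-indices `i ∈ [d]^n`; they label the computational basis of `(ℂ^d)^{⊗n}`. -/
abbrev MIdx (d n : ℕ) : Type := Fin n → Fin d

/-- Matrices in `(M_d(ℂ))^{⊗n}`, written in the computational basis of `(ℂ^d)^{⊗n}`. -/
abbrev MultiMat (d n : ℕ) : Type := Matrix (MIdx d n) (MIdx d n) ℂ

/-- The permutation operator `P_π = ∑_i |i_{π⁻¹(1)} … i_{π⁻¹(n)}⟩⟨i_1 … i_n|`. -/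
def permOp (d : ℕ) {n : ℕ} (π : Equiv.Perm (Fin n)) : MultiMat d n :=
  ∑ i : MIdx d n, Matrix.single (fun k => i (π⁻¹ k)) i 1

/-- The projection onto the symmetric subspace, `Π = (1 / n!) ∑_π P_π`. -/
def symProj (d n : ℕ) : MultiMat d n :=
  ((n.factorial : ℂ)⁻¹) • ∑ π : Equiv.Perm (Fin n), permOp d π

/-- The tensor power `U^{⊗n}` of a `d × d` matrix. -/
def tensorPow {d : ℕ} (n : ℕ) (U : Matrix (Fin d) (Fin d) ℂ) : MultiMat d n :=
  Matrix.of fun i j => ∏ k : Fin n, U (i k) (j k)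

/-- The diagonal unitary `diag(e^{iθ_1}, …, e^{iθ_d})`. -/
def diagUnitary {d : ℕ} (θ : Fin d → ℝ) : Matrix (Fin d) (Fin d) ℂ :=
  Matrix.diagonal fun j => Complex.exp (Complex.I * (θ j : ℂ))

/-- Bosonic matrices: `Π X Π = X`. -/
def IsBosonic {d n : ℕ} (X : MultiMat d n) : Prop :=
  symProj d n * X * symProj d n = X

/-- `Herm[DS]`: Hermitian bosonic matrices that commute with `U^{⊗n}` for every diagonal
unitary `U`. -/
def HermDS (d n : ℕ) : Set (MultiMat d n) :=
  {X | X.IsHermitian ∧ IsBosonic X ∧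
    ∀ θ : Fin d → ℝ, tensorPow n (diagUnitary θ) * X = X * tensorPow n (diagUnitary θ)}

/-- The partial transpose `X^{Γ_I}`: the tensor factors with index in `I` are transposed. -/
def partialTranspose {d n : ℕ} (I : Finset (Fin n)) (X : MultiMat d n) : MultiMat d n :=
  Matrix.of fun i j =>
    X (fun k => if k ∈ I then j k else i k) (fun k => if k ∈ I then i k else j k)

/-- `X` is PPT with respect to the bipartition `I : [n] \ I`. -/
def IsPPT {d n : ℕ} (I : Finset (Fin n)) (X : MultiMat d n) : Prop :=
  (partialTranspose I X).PosSemidef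

/-- The set `[k]` of the first `k` of `n` parties. -/
def firstParties (n k : ℕ) : Finset (Fin n) :=
  Finset.univ.filter fun i => (i : ℕ) < k

/-- The cone of Hermitian bosonic matrices that are PPT with respect to `[k] : [n] \ [k]`. -/
def PPTCone (d n k : ℕ) : Set (MultiMat d n) :=
  {X | X.IsHermitian ∧ IsBosonic X ∧ IsPPT (firstParties n k) X}

/-- The occupation vector `γ(i)_j = #{k | i_k = j}`. -/
def occupation {d n : ℕ} (i : MIdx d n) : Fin d → ℕ :=
  fun j => (Finset.univ.filter fun k => i k = j).card

/-- The Dicke vector `|D_α⟩ = (n choose α)^{-1/2} ∑_{γ(i) = α} |i⟩`, for `|α| = n`. -/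
def dickeVec (d n : ℕ) (α : Fin d → ℕ) : MIdx d n → ℂ :=
  fun i => if occupation i = α
    then (((Real.sqrt (Nat.multinomial Finset.univ α : ℝ))⁻¹ : ℝ) : ℂ) else 0

/-- The pure state `|D_α⟩⟨D_α|`. -/
def dickeProj (d n : ℕ) (α : Fin d → ℕ) : MultiMat d n :=
  Matrix.vecMulVec (dickeVec d n α) (star (dickeVec d n α))

/-- Mixtures of Dicke states: `∑_α p_α |D_α⟩⟨D_α|`, where `p` is a probability distribution on
the occupation vectors `α ∈ ℕ^d` with `|α| = n`. -/
def IsDickeMixture {d n : ℕ} (X : MultiMat d n) : Prop :=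
  ∃ p : (Fin d → ℕ) → ℝ, (∀ α, 0 ≤ p α) ∧
    ∑ α ∈ Finset.piAntidiag (Finset.univ : Finset (Fin d)) n, p α = 1 ∧
    X = ∑ α ∈ Finset.piAntidiag (Finset.univ : Finset (Fin d)) n, (p α : ℂ) • dickeProj d n α

end DickePPT

end

/-!
A matrix in `HermDS` has entries `X i j = x (γ i)` if `γ i = γ j` and `0` otherwise, where `γ` is
the occupation vector (`IsOccDiag`): bosonic symmetry makes the entries functions of the two
occupation vectors, and commutation with diagonal unitaries kills the entries with `γ i ≠ γ j`.
Mixtures of Dicke states visibly have the same form.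

For such an `X` and a set `I` of parties, let `a i` and `b i` be the occupation vectors of the
restrictions of `i` to `I` and to its complement. The `(i, j)` entry of `X^{Γ_I}` vanishes unless
`a i - b i = a j - b j`, so `X^{Γ_I}` is block diagonal, the blocks being labelled by
`δ = a i - b i ∈ ℤ^d`. With `e i = min (a i) (b i)`, taken coordinatewise, one has
`a j + b i = e i + e j + |δ|` inside a block, so the entry is `x (e i + e j + |δ|)`: it depends on
the block only through `|δ|`.

Now let `I₀` be balanced. Since `2 |e i| + ∑ |δ| = n`, the vector `|δ|` can be split as `c₁ + c₂`
so that `e i + c₁` has total `|I₀|` and `e i + c₂` has total `n - |I₀|`, and the splitting depends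
only on `δ`. Choosing a multi-index `φ i` with these occupation vectors on `I₀` and on its
complement identifies the block of `X^{Γ_I}` with a compression of `X^{Γ_{I₀}}` along `φ`
(`exists_rebalancing`). Hence `X^{Γ_I}` is the Hadamard product of a compression of `X^{Γ_{I₀}}`
with the positive semidefinite 0-1 matrix of the block partition, and Schur's product theorem
concludes (`IsOccDiag.isPPT_of_balanced`).
-/

open Matrix

namespace DickePPT

/-! ### Symmetrization and occupation vectors -/

lemma permOp_apply {d n : ℕ} (π : Equiv.Perm (Fin n)) (i j : MIdx d n) :
    permOp d π i j = if i = j ∘ ⇑π⁻¹ then 1 else 0 := by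
  simp only [permOp, Matrix.sum_apply, Matrix.single_apply]
  rw [Finset.sum_eq_single j]
  · simp [Function.comp_def, eq_comm]
  · intro b _ hb
    simp [hb]
  · simp

lemma permOp_mul_apply {d n : ℕ} (π : Equiv.Perm (Fin n)) (M : MultiMat d n) (i j : MIdx d n) :
    (permOp d π * M) i j = M (i ∘ π) j := by
  rw [Matrix.mul_apply, Finset.sum_eq_single (i ∘ π)]
  · rw [permOp_apply, if_pos (funext fun k => by simp), one_mul]
  · intro b _ hb
    rw [permOp_apply, if_neg, zero_mul]
    rintro rfl
    exact hb (funext fun k => by simp)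
  · simp

lemma mul_permOp_apply {d n : ℕ} (π : Equiv.Perm (Fin n)) (M : MultiMat d n) (i j : MIdx d n) :
    (M * permOp d π) i j = M i (j ∘ ⇑π⁻¹) := by
  simp [Matrix.mul_apply, permOp_apply]

lemma symProj_mul_comp_perm {d n : ℕ} (σ : Equiv.Perm (Fin n)) (M : MultiMat d n)
    (i j : MIdx d n) : (symProj d n * M) (i ∘ σ) j = (symProj d n * M) i j := by
  simp only [symProj, Matrix.smul_mul, Matrix.smul_apply, Finset.sum_mul, Matrix.sum_apply,
    permOp_mul_apply]
  congr 1
  exact Fintype.sum_equiv (Equiv.mulLeft σ) _ _ fun π => by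
    simp [Function.comp_assoc, Equiv.Perm.coe_mul]

lemma mul_symProj_comp_perm {d n : ℕ} (σ : Equiv.Perm (Fin n)) (M : MultiMat d n)
    (i j : MIdx d n) : (M * symProj d n) i (j ∘ σ) = (M * symProj d n) i j := by
  simp only [symProj, Matrix.mul_smul, Matrix.smul_apply, Finset.mul_sum, Matrix.sum_apply,
    mul_permOp_apply]
  congr 1
  exact Fintype.sum_equiv (Equiv.mulRight σ⁻¹) _ _ fun π => by
    simp [Function.comp_assoc, Equiv.Perm.coe_mul]

lemma IsBosonic.apply_comp_perm {d n : ℕ} {X : MultiMat d n} (hX : IsBosonic X)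
    (σ τ : Equiv.Perm (Fin n)) (i j : MIdx d n) : X (i ∘ σ) (j ∘ τ) = X i j := by
  rw [IsBosonic] at hX
  rw [← hX, mul_symProj_comp_perm, Matrix.mul_assoc, symProj_mul_comp_perm]

lemma exists_perm_of_occupation_eq {d n : ℕ} {i j : MIdx d n} (h : occupation i = occupation j) :
    ∃ σ : Equiv.Perm (Fin n), i = j ∘ σ := by
  have e : ∀ c, Nonempty ({k // i k = c} ≃ {k // j k = c}) := fun c => by
    have hc := congrFun h c
    simp only [occupation] at hc
    rw [← Fintype.card_eq, Fintype.card_subtype, Fintype.card_subtype, hc]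
  exact ⟨Equiv.ofFiberEquiv fun c => (e c).some,
    funext fun k => (Equiv.ofFiberEquiv_map (fun c => (e c).some) k).symm⟩

/-! ### The matrix form of `HermDS` and of Dicke mixtures -/

/-- `X` is diagonal in the Dicke basis: its entries are `x (γ i)` if the occupation vectors
`γ i`, `γ j` agree and `0` otherwise. -/
def IsOccDiag {d n : ℕ} (x : (Fin d → ℕ) → ℂ) (X : MultiMat d n) : Prop :=
  ∀ i j, X i j = if occupation i = occupation j then x (occupation i) else 0

lemma tensorPow_diagonal {d : ℕ} (n : ℕ) (u : Fin d → ℂ) :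
    tensorPow n (Matrix.diagonal u) = Matrix.diagonal fun i : MIdx d n => ∏ k, u (i k) := by
  ext i j
  rcases eq_or_ne i j with rfl | hij
  · simp [tensorPow]
  · obtain ⟨k, hk⟩ := Function.ne_iff.mp hij
    rw [Matrix.diagonal_apply_ne _ hij, tensorPow, Matrix.of_apply]
    exact Finset.prod_eq_zero (Finset.mem_univ k) (Matrix.diagonal_apply_ne _ hk)

lemma apply_eq_zero_of_commute {d n : ℕ} {X : MultiMat d n}
    (hX : ∀ θ : Fin d → ℝ, tensorPow n (diagUnitary θ) * X = X * tensorPow n (diagUnitary θ))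
    {i j : MIdx d n} (hij : occupation i ≠ occupation j) : X i j = 0 := by
  obtain ⟨m, hm⟩ := Function.ne_iff.mp hij
  have hne : ((occupation i m : ℝ) - occupation j m) ≠ 0 :=
    sub_ne_zero.mpr (Nat.cast_injective.ne hm)
  -- this angle gives the two occupation numbers of `m` opposite phases
  set t : ℝ := Real.pi / ((occupation i m : ℝ) - occupation j m) with ht
  have phase : ∀ l : MIdx d n,
      ∏ k, Complex.exp (Complex.I * ((Pi.single m t : Fin d → ℝ) (l k) : ℂ)) =
        Complex.exp (Complex.I * ((occupation l m * t : ℝ) : ℂ)) := fun l => by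
    rw [← Complex.exp_sum, ← Finset.mul_sum, ← Complex.ofReal_sum]
    congr 3
    simp [Pi.single_apply, Finset.sum_ite, occupation]
  have h := congrFun (congrFun (hX (Pi.single m t)) i) j
  rw [diagUnitary, tensorPow_diagonal, Matrix.diagonal_mul, Matrix.mul_diagonal, phase, phase,
    mul_comm] at h
  by_contra h0
  obtain ⟨N, hN⟩ := Complex.exp_eq_exp_iff_exists_int.mp (mul_left_cancel₀ h0 h)
  have h1 : occupation i m * t = occupation j m * t + N * (2 * Real.pi) := by
    have := congrArg Complex.im hN
    simpa using this
  have h2 : ((occupation i m : ℝ) - occupation j m) * t = Real.pi := by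
    rw [ht]; field_simp
  have h3 : Real.pi * 1 = Real.pi * (2 * N) := by linarith
  have h4 : (1 : ℝ) = 2 * N := mul_left_cancel₀ Real.pi_ne_zero h3
  have h5 : (1 : ℤ) = 2 * N := by exact_mod_cast h4
  omega

open Classical in
lemma exists_isOccDiag_of_mem_hermDS {d n : ℕ} {X : MultiMat d n} (hX : X ∈ HermDS d n) :
    ∃ x, IsOccDiag x X := by
  obtain ⟨-, hbos, hcomm⟩ := hX
  refine ⟨fun α => if h : ∃ i : MIdx d n, occupation i = α then X h.choose h.choose else 0,
    fun i j => ?_⟩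
  split_ifs with hij
  · have hex : ∃ l : MIdx d n, occupation l = occupation i := ⟨i, rfl⟩
    simp only [dif_pos hex]
    obtain ⟨σ, hσ⟩ := exists_perm_of_occupation_eq hex.choose_spec.symm
    obtain ⟨τ, hτ⟩ := exists_perm_of_occupation_eq (hij.symm.trans hex.choose_spec.symm)
    conv_lhs => rw [hσ, hτ]
    exact hbos.apply_comp_perm σ τ _ _
  · exact apply_eq_zero_of_commute hcomm hij

lemma sum_occupation {d n : ℕ} (i : MIdx d n) : ∑ m, occupation i m = n := by
  simpa [occupation] using
    (Finset.card_eq_sum_card_fiberwise (s := Finset.univ) (t := Finset.univ) (f := i)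
      (by simp)).symm

lemma IsDickeMixture.exists_isOccDiag {d n : ℕ} {X : MultiMat d n} (hX : IsDickeMixture X) :
    ∃ x, IsOccDiag x X := by
  obtain ⟨p, -, -, rfl⟩ := hX
  refine ⟨fun α => p α * ((((Real.sqrt (Nat.multinomial Finset.univ α : ℝ))⁻¹ : ℝ) : ℂ) *
    star (((Real.sqrt (Nat.multinomial Finset.univ α : ℝ))⁻¹ : ℝ) : ℂ)), fun i j => ?_⟩
  simp only [Matrix.sum_apply, Matrix.smul_apply, smul_eq_mul, dickeProj, Matrix.vecMulVec_apply,
    Pi.star_apply]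
  rw [Finset.sum_eq_single (occupation i)]
  · by_cases hij : occupation i = occupation j
    · simp [dickeVec, hij]
    · simp [dickeVec, hij, Ne.symm hij]
  · intro α _ hα
    simp [dickeVec, hα.symm]
  · intro h
    exact absurd (by simp [sum_occupation]) h

/-! ### Occupation vectors on a set of parties -/

/-- The occupation vector of the restriction of a multi-index to the parties in `I`. -/
def occOn {d n : ℕ} (I : Finset (Fin n)) (i : MIdx d n) : Fin d → ℕ :=
  fun m => (I.filter fun k => i k = m).card

lemma sum_occOn {d n : ℕ} (I : Finset (Fin n)) (i : MIdx d n) : ∑ m, occOn I i m = I.card :=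
  (Finset.card_eq_sum_card_fiberwise (s := I) (t := Finset.univ) (f := i) (by simp)).symm

lemma occOn_congr {d n : ℕ} {I : Finset (Fin n)} {i j : MIdx d n} (h : ∀ k ∈ I, i k = j k) :
    occOn I i = occOn I j :=
  funext fun m => congrArg Finset.card (Finset.filter_congr fun k hk => by rw [h k hk])

lemma occupation_eq_occOn_add {d n : ℕ} (I : Finset (Fin n)) (i : MIdx d n) :
    occupation i = occOn I i + occOn Iᶜ i := by
  funext m
  simp only [occupation, occOn, Pi.add_apply, Finset.card_filter]
  exact (Finset.sum_add_sum_compl I _).symm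

lemma occupation_ite {d n : ℕ} (I : Finset (Fin n)) (i j : MIdx d n) :
    occupation (fun k => if k ∈ I then j k else i k) = occOn I j + occOn Iᶜ i := by
  rw [occupation_eq_occOn_add I]
  congr 1
  · exact occOn_congr fun k hk => if_pos hk
  · exact occOn_congr fun k hk => if_neg (Finset.mem_compl.mp hk)

lemma IsOccDiag.partialTranspose_apply {d n : ℕ} {x : (Fin d → ℕ) → ℂ} {X : MultiMat d n}
    (hX : IsOccDiag x X) (I : Finset (Fin n)) (i j : MIdx d n) :
    partialTranspose I X i j =
      if occOn I j + occOn Iᶜ i = occOn I i + occOn Iᶜ j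
        then x (occOn I j + occOn Iᶜ i) else 0 := by
  rw [partialTranspose, Matrix.of_apply, hX, occupation_ite, occupation_ite]

lemma exists_card_fiber_eq {d : ℕ} {ι : Type*} [Fintype ι] (a : Fin d → ℕ)
    (h : Fintype.card ι = ∑ m, a m) :
    ∃ f : ι → Fin d, ∀ m, (Finset.univ.filter fun k => f k = m).card = a m := by
  have e : Nonempty (ι ≃ Σ m, Fin (a m)) := by
    rw [← Fintype.card_eq, h]
    simp
  obtain ⟨e⟩ := e
  refine ⟨fun k => (e k).1, fun m => ?_⟩
  rw [← Fintype.card_subtype, ← Fintype.card_fin (a m)]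
  exact Fintype.card_congr ((e.subtypeEquiv fun _ => Iff.rfl).trans (Equiv.sigmaSubtype m))

lemma exists_occOn_eq {d n : ℕ} (I : Finset (Fin n)) (a b : Fin d → ℕ)
    (ha : ∑ m, a m = I.card) (hb : ∑ m, b m = Iᶜ.card) :
    ∃ i : MIdx d n, occOn I i = a ∧ occOn Iᶜ i = b := by
  obtain ⟨f, hf⟩ := exists_card_fiber_eq (ι := I) a (by simp [ha])
  obtain ⟨g, hg⟩ := exists_card_fiber_eq (ι := (Iᶜ : Finset (Fin n))) b
    (by simp only [hb, Fintype.card_coe])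
  refine ⟨fun k => if h : k ∈ I then f ⟨k, h⟩ else g ⟨k, Finset.mem_compl.mpr h⟩, ?_, ?_⟩
  · funext m
    rw [← hf m, occOn, Finset.card_filter, Finset.card_filter, ← Finset.sum_coe_sort]
    exact Finset.sum_congr rfl fun k _ => by simp
  · funext m
    rw [← hg m, occOn, Finset.card_filter, Finset.card_filter, ← Finset.sum_coe_sort]
    refine Finset.sum_congr rfl fun k _ => ?_
    rw [dif_neg (Finset.mem_compl.mp k.2)]

/-! ### Rebalancing the blocks of a partial transpose -/

lemma exists_le_sum_eq {ι : Type*} [Fintype ι] (c : ι → ℕ) (s : ℕ) (hs : s ≤ ∑ m, c m) :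
    ∃ c₁ ≤ c, ∑ m, c₁ m = s := by
  classical
  induction s with
  | zero => exact ⟨0, fun _ => Nat.zero_le _, by simp⟩
  | succ s ih =>
    obtain ⟨c₁, hle, hsum⟩ := ih (by omega)
    obtain ⟨m, -, hm⟩ : ∃ m ∈ Finset.univ, c₁ m < c m :=
      Finset.exists_lt_of_sum_lt (by omega)
    refine ⟨c₁ + Pi.single m 1, fun l => ?_, ?_⟩
    · rcases eq_or_ne l m with rfl | hl
      · simpa using hm
      · simpa [hl] using hle l
    · simp [Finset.sum_add_distrib, hsum]

/-- The label `δ` of the block of `X^{Γ_I}` that contains `i`: the difference of the occupation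
vectors of `i` on `I` and on its complement. -/
def blockLabel {d n : ℕ} (I : Finset (Fin n)) (i : MIdx d n) : Fin d → ℤ :=
  fun m => (occOn I i m : ℤ) - occOn Iᶜ i m

/-- Every multi-index `i` can be replaced by some `φ i` whose occupation vectors on `I₀` and `I₀ᶜ`
arise from the common part `min (occOn I i) (occOn Iᶜ i)` by adding vectors `c₁`, `c₂` that depend
only on the block label of `i` and satisfy `c₁ + c₂ = |blockLabel I i|`. Within a block, this
preserves the entries `x (occOn I j + occOn Iᶜ i)` of the partial transpose. -/
lemma exists_rebalancing {d n : ℕ} (I I₀ : Finset (Fin n)) (hI₀ : I₀.card = n / 2) :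
    ∃ φ : MIdx d n → MIdx d n, ∀ i j, blockLabel I i = blockLabel I j →
      occOn I₀ (φ j) + occOn I₀ᶜ (φ i) = occOn I j + occOn Iᶜ i := by
  have split : ∀ δ : Fin d → ℤ, ∃ c₁ c₂ : Fin d → ℕ,
      (∀ m, c₁ m + c₂ m = (δ m).natAbs) ∧ ∑ m, c₁ m = (∑ m, (δ m).natAbs) / 2 := fun δ => by
    obtain ⟨c₁, hle, hsum⟩ := exists_le_sum_eq (fun m => (δ m).natAbs)
      ((∑ m, (δ m).natAbs) / 2) (Nat.div_le_self _ _)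
    exact ⟨c₁, fun m => (δ m).natAbs - c₁ m, fun m => Nat.add_sub_cancel' (hle m), hsum⟩
  choose c₁ c₂ hc hc₁ using split
  have key : ∀ i : MIdx d n, ∃ i' : MIdx d n,
      occOn I₀ i' = (fun m => min (occOn I i m) (occOn Iᶜ i m) + c₁ (blockLabel I i) m) ∧
      occOn I₀ᶜ i' = (fun m => min (occOn I i m) (occOn Iᶜ i m) + c₂ (blockLabel I i) m) := by
    intro i
    have hn : n = 2 * ∑ m, min (occOn I i m) (occOn Iᶜ i m) + ∑ m, (blockLabel I i m).natAbs := by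
      conv_lhs => rw [← sum_occupation i, occupation_eq_occOn_add I]
      rw [Finset.mul_sum, ← Finset.sum_add_distrib]
      refine Finset.sum_congr rfl fun m _ => ?_
      simp only [blockLabel, Pi.add_apply]
      omega
    have h₁ := hc₁ (blockLabel I i)
    have h₂ : ∑ m, c₁ (blockLabel I i) m + ∑ m, c₂ (blockLabel I i) m =
        ∑ m, (blockLabel I i m).natAbs := by
      rw [← Finset.sum_add_distrib]
      exact Finset.sum_congr rfl fun m _ => hc _ m
    apply exists_occOn_eq
    · rw [Finset.sum_add_distrib]
      omega
    · rw [Finset.sum_add_distrib, Finset.card_compl, Fintype.card_fin]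
      omega
  choose φ hφ₁ hφ₂ using key
  refine ⟨φ, fun i j hij => funext fun m => ?_⟩
  have h := hc (blockLabel I i) m
  have hm := congrFun hij m
  simp only [Pi.add_apply, hφ₁, hφ₂, ← hij]
  simp only [blockLabel] at h hm ⊢
  omega

theorem IsOccDiag.isPPT_of_balanced {d n : ℕ} {x : (Fin d → ℕ) → ℂ} {X : MultiMat d n}
    (hX : IsOccDiag x X) {I₀ : Finset (Fin n)} (hI₀ : I₀.card = n / 2) (h : IsPPT I₀ X)
    (I : Finset (Fin n)) : IsPPT I X := by
  obtain ⟨φ, hφ⟩ := exists_rebalancing (d := d) I I₀ hI₀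
  have hblock : ((1 : Matrix (Fin d → ℤ) (Fin d → ℤ) ℂ).submatrix
      (blockLabel I : MIdx d n → _) (blockLabel I)).PosSemidef := Matrix.PosSemidef.one.submatrix _
  have heq : partialTranspose I X =
      ((partialTranspose I₀ X).submatrix φ φ) ⊙
        (1 : Matrix (Fin d → ℤ) (Fin d → ℤ) ℂ).submatrix (blockLabel I) (blockLabel I) := by
    ext i j
    have hiff : occOn I j + occOn Iᶜ i = occOn I i + occOn Iᶜ j ↔
        blockLabel I i = blockLabel I j := by
      simp only [funext_iff, blockLabel, Pi.add_apply]
      exact forall_congr' fun m => by omega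
    rw [Matrix.hadamard_apply, Matrix.submatrix_apply, Matrix.submatrix_apply,
      hX.partialTranspose_apply, hX.partialTranspose_apply, Matrix.one_apply]
    by_cases hij : blockLabel I i = blockLabel I j
    · have h' := hφ j i hij.symm
      rw [hφ i j hij, h', if_pos (hiff.mpr hij), if_pos hij, mul_one]
    · rw [if_neg (mt hiff.mp hij), if_neg hij, mul_zero]
  rw [IsPPT, heq]
  exact (Matrix.PosSemidef.submatrix h φ).hadamard hblock

lemma card_firstParties {n k : ℕ} (hk : k ≤ n) : (firstParties n k).card = k := by
  simp [firstParties, Fin.card_filter_val_lt, hk]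

end DickePPT

theorem mainTheorem2 (d n : ℕ) :
    -- inclusions of cones
    (∀ l : ℕ, l ≤ n / 2 →
      DickePPT.PPTCone d n (n / 2) ∩ DickePPT.HermDS d n ⊆
        DickePPT.PPTCone d n l ∩ DickePPT.HermDS d n) ∧
    -- every balanced bipartition against every bipartition
    (∀ X : DickePPT.MultiMat d n, X ∈ DickePPT.HermDS d n →
      ∀ I₀ : Finset (Fin n), I₀.card = n / 2 → DickePPT.IsPPT I₀ X →
        ∀ I : Finset (Fin n), DickePPT.IsPPT I X) ∧
    -- the same for mixtures of Dicke states
    (∀ X : DickePPT.MultiMat d n, DickePPT.IsDickeMixture X →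
      ∀ I₀ : Finset (Fin n), I₀.card = n / 2 → DickePPT.IsPPT I₀ X →
        ∀ I : Finset (Fin n), DickePPT.IsPPT I X) := by
  have hermDS : ∀ X ∈ DickePPT.HermDS d n, ∀ I₀ : Finset (Fin n), I₀.card = n / 2 →
      DickePPT.IsPPT I₀ X → ∀ I, DickePPT.IsPPT I X := fun X hX I₀ hI₀ h I => by
    obtain ⟨x, hx⟩ := DickePPT.exists_isOccDiag_of_mem_hermDS hX
    exact hx.isPPT_of_balanced hI₀ h I
  refine ⟨?_, hermDS, ?_⟩
  · rintro l - X ⟨⟨hherm, hbos, hppt⟩, hX⟩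
    exact ⟨⟨hherm, hbos, hermDS X hX _
      (DickePPT.card_firstParties (Nat.div_le_self n 2)) hppt _⟩, hX⟩
  · intro X hX I₀ hI₀ h I
    obtain ⟨x, hx⟩ := hX.exists_isOccDiag
    exact hx.isPPT_of_balanced hI₀ h I
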